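/- **Setting.** Let $X_1,\dots,X_n$ be i.i.d. from a probability measure $P_0$ on a measurable space $(\mathcal X,\mathcal B)$. For each $n$ let $W_{n1},\dots,W_{nn}$ be i.i.d. with law $Q_n$ on a measurable space $(\mathcal W_n,\mathcal C_n)$, independent of the data, and let $X_i^*=\gamma_n(X_1,\dots,X_n,W_{ni})$ with $\gamma_n$ a fixed jointly measurable function. Let $\hat P_n$ be the conditional law of $X_i^*$ given $X_1,\dots,X_n$ (the law of $\gamma_n(X_1,\dots,X_n,W)$ for $W\sim Q_n$), let $\mathbb P_n^*$ be the empirical distribution of $X_1^*,\dots,X_n^*$, and let $\mathbb G_n^*=n^{1/2}(\mathbb P_n^*-\hat P_n)$. Write $Pf=\int f\,dP$. Let $\mathcal H$ be a set and let $T$ be a real-valued function of $(\eta,P)$, with $\eta\in\mathcal H$ and $P$ a probability measure on $(\mathcal X,\mathcal B)$. Let $\eta_n\in\mathcal H$ be a function of the data, and let $\eta_n^*\in\mathcal H$ and $\phi_n^*:\mathcal X\to\mathbb R$ be functions of the data and of $W_{n1},\dots,W_{nn}$ (no measurability is assumed of them). Let $\phi_0:\mathcal X\to\mathbb R$ be a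 fixed function (the influence function), and set $$R_n^*=T(\eta_n^*,\mathbb P_n^*)-T(\eta_n,\hat P_n)-(\mathbb P_n^*-\hat P_n)\phi_n^*.$$ **Conditional convergence.** $P_0^*$ is outer probability for the data, and $Z_n\xrightarrow{P_0^*}c$ means $P_0^*(|Z_n-c|\ge\varepsilon)\to0$ for all $\varepsilon>0$. For a bounded function $h$ of $(x_1,\dots,x_n,w_1,\dots,w_n)$, $E_W^*h$ is the conditional outer expectation given the data: the infimum of $\int U\,dQ_n^n$ over measurable $U$ on $\mathcal W_n^n$ with $U\ge h(X_1,\dots,X_n,\cdot)$ almost surely and $U$ integrable; and $P_W^*(A)=E_W^*1_A$. For $r_n>0$, $Y_n=o_{P_W^*}(r_n)$ means that $P_W^*(|Y_n|\ge\varepsilon r_n)\xrightarrow{P_0^*}0$ for every $\varepsilon>0$. For a metric space $\mathbb D$ let $\mathrm{BL}_1(\mathbb D)$ be the set of 1-Lipschitz functions $\mathbb D\to[-1,1]$. Possibly non-measurable $\mathbb D$-valued $G_n$ converge weakly, conditionally in outer probability, to a tight Borel measurable $G$ in $\mathbb D$ if $$\sup_{h\in\mathrm{BL}_1(\mathbb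 D)}\bigl|E_W^*h(G_n)-E\,h(G)\bigr|\xrightarrow{P_0^*}0.$$ For a set $\mathcal F$ of functions, $\ell^\infty(\mathcal F)$ is the Banach space of bounded functions $\mathcal F\to\mathbb R$ with the supremum norm. **Theorem.** Assume: (B1) There is a class $\mathcal F$ of measurable functions $\mathcal X\to\mathbb R$ such that (a) $\phi_0\in\mathcal F$ and $P_W^*(\phi_n^*\notin\mathcal F)\xrightarrow{P_0^*}0$; and (b) $\mathbb G_n^*$ converges weakly, conditionally in outer probability, to $\mathbb G_0$ in $\ell^\infty(\mathcal F)$, where $\mathbb G_0$ is the $P_0$-Brownian bridge: a tight, Borel measurable, mean-zero Gaussian process in $\ell^\infty(\mathcal F)$ with covariance $P_0(fg)-P_0f\,P_0g$, where $\mathcal F\subset L_2(P_0)$. (It is implicit in (b) that for every $n\ge1$, almost surely, every $f\in\mathcal F$ is $\hat P_n$-integrable and $f\mapsto\mathbb G_n^*f$ is bounded on $\mathcal F$.) (B2) $\|\phi_n^*-\phi_0\|_{L_2(P_0)}=o_{P_W^*}(1)$. (B3) $R_n^*=o_{P_W^*}(n^{-1/2})$. Then $T(\eta_n^*,\mathbb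 P_n^*)$ is conditionally asymptotically linear, $$T(\eta_n^*,\mathbb P_n^*)=T(\eta_n,\hat P_n)+(\mathbb P_n^*-\hat P_n)\phi_0+o_{P_W^*}(n^{-1/2}),$$ and $n^{1/2}\bigl[T(\eta_n^*,\mathbb P_n^*)-T(\eta_n,\hat P_n)\bigr]$ converges weakly in $\mathbb R$, conditionally in outer probability, to $\mathbb G_0(\phi_0)$. -/

import Mathlib

open MeasureTheory ProbabilityTheory Filter Topology
open scoped ENNReal

namespace CondBootstrap

noncomputable section

/-! ### Outer expectations, conditional outer convergence -/

/-- The outer expectation of a bounded, possibly non-measurable function `h` on a probability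
space: the infimum of the expectations of the measurable functions `U` with `h ≤ U` almost surely.
(For bounded `h`, the only case used below, majorants with infinite expectation do not
change the infimum.) -/
def outerExp {Ω : Type*} [MeasurableSpace Ω] (μ : Measure Ω) (h : Ω → ℝ) : ℝ :=
  sInf {c : ℝ | ∃ U : Ω → ℝ, Measurable U ∧ Integrable U μ ∧ (∀ᵐ ω ∂μ, h ω ≤ U ω) ∧
    ∫ ω, U ω ∂μ = c}

/-- The outer probability of an arbitrary set: the outer expectation of its indicator. -/
def outerProb {Ω : Type*} [MeasurableSpace Ω] (μ : Measure Ω) (A : Set Ω) : ℝ :=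
  outerExp μ (A.indicator fun _ => (1 : ℝ))

variable {X : Type*} [MeasurableSpace X] {W : ℕ → Type*} [∀ n, MeasurableSpace (W n)]

/-- `Z_n → c` in outer probability, for arbitrary functions `Z_n` of an i.i.d. sample
`X_1, …, X_n` from `P₀`. -/
def TendstoInOuterProb (P₀ : Measure X) (Z : ∀ n, (Fin n → X) → ℝ) (c : ℝ) : Prop :=
  ∀ ε : ℝ, 0 < ε →
    Tendsto (fun n => outerProb (Measure.pi fun _ : Fin n => P₀) {x | ε ≤ |Z n x - c|})
      atTop (𝓝 0)

/-- The conditional outer expectation `E_W^* h` given the data `x = (x_1, …, x_n)`, where the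
auxiliary variables `w_1, …, w_n` are i.i.d. from `Q n`. -/
def condOuterExp (Q : ∀ n, Measure (W n)) (n : ℕ) (h : (Fin n → X) → (Fin n → W n) → ℝ)
    (x : Fin n → X) : ℝ :=
  outerExp (Measure.pi fun _ : Fin n => Q n) (h x)

/-- The conditional outer probability `P_W^*` of the event `A` given the data. -/
def condOuterProb (Q : ∀ n, Measure (W n)) (n : ℕ) (A : (Fin n → X) → Set (Fin n → W n))
    (x : Fin n → X) : ℝ :=
  outerProb (Measure.pi fun _ : Fin n => Q n) (A x)

/-- `Y_n = o_{P_W^*}(r_n)` for `[0, ∞]`-valued `Y_n` (real `Y_n` enter through `|Y_n|`) and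
positive rates `r_n`: for every `ε > 0`, `P_W^*(Y_n ≥ ε r_n) → 0` in outer probability. -/
def IsCondLittleO (P₀ : Measure X) (Q : ∀ n, Measure (W n))
    (Y : ∀ n, (Fin n → X) → (Fin n → W n) → ℝ≥0∞) (r : ℕ → ℝ) : Prop :=
  ∀ ε : ℝ, 0 < ε →
    TendstoInOuterProb P₀
      (fun n => condOuterProb Q n fun x => {w | ENNReal.ofReal (ε * r n) ≤ Y n x w}) 0

/-- `BL₁(D)`: the 1-Lipschitz functions `D → [-1, 1]`. -/
def BL₁ (D : Type*) [PseudoMetricSpace D] : Set (D → ℝ) :=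
  {h | LipschitzWith 1 h ∧ ∀ z, |h z| ≤ 1}

/-- `G` is a Borel measurable map into the metric space `D` whose law is tight. -/
def IsTightBorel {Ω D : Type*} [MeasurableSpace Ω] [PseudoMetricSpace D] (μ : Measure Ω)
    (G : Ω → D) : Prop :=
  (∀ U : Set D, IsOpen U → MeasurableSet (G ⁻¹' U)) ∧
    ∀ ε : ℝ≥0∞, 0 < ε → ∃ K : Set D, IsCompact K ∧ μ {ω | G ω ∉ K} ≤ ε

/-- Conditional weak convergence in outer probability of (possibly non-measurable) `D`-valued
`G_n`, given the data, to the tight Borel measurable limit `G`: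
`sup_{h ∈ BL₁(D)} |E_W^* h(G_n) - E h(G)| → 0` in outer probability. -/
def CondWeakConv {Ω D : Type*} [MeasurableSpace Ω] [PseudoMetricSpace D] (P₀ : Measure X)
    (Q : ∀ n, Measure (W n)) (Gn : ∀ n, (Fin n → X) → (Fin n → W n) → D)
    (μ : Measure Ω) (G : Ω → D) : Prop :=
  IsTightBorel μ G ∧
    TendstoInOuterProb P₀
      (fun n x => ⨆ h : BL₁ D,
        |condOuterExp Q n (fun x w => h.1 (Gn n x w)) x - ∫ ω, h.1 (G ω) ∂μ|) 0

/-! ### The bootstrap -/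

/-- The empirical distribution of `x_1, …, x_n`. -/
def empirical {n : ℕ} (x : Fin n → X) : Measure X :=
  (n : ℝ≥0∞)⁻¹ • ∑ i, Measure.dirac (x i)

/-- The bootstrap sampling distribution `P̂_n`: the conditional law of
`X_i^* = γ_n(X_1, …, X_n, W_{ni})` given `X_1, …, X_n`. -/
def Phat (Q : ∀ n, Measure (W n)) (γ : ∀ n, (Fin n → X) → W n → X) (n : ℕ) (x : Fin n → X) :
    Measure X :=
  (Q n).map (γ n x)

/-- The bootstrap empirical distribution `P_n^*`: the empirical distribution of
`X_1^*, …, X_n^*`. -/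
def Pstar (γ : ∀ n, (Fin n → X) → W n → X) (n : ℕ) (x : Fin n → X) (w : Fin n → W n) :
    Measure X :=
  empirical fun i => γ n x (w i)

/-- `(P_n^* - P̂_n) f`. -/
def centered (Q : ∀ n, Measure (W n)) (γ : ∀ n, (Fin n → X) → W n → X) (n : ℕ)
    (x : Fin n → X) (w : Fin n → W n) (f : X → ℝ) : ℝ :=
  ∫ y, f y ∂(Pstar γ n x w) - ∫ y, f y ∂(Phat Q γ n x)

/-- The Banach space `ℓ^∞(F)` of bounded functions `F → ℝ` with the supremum norm. -/
abbrev EllInf (F : Set (X → ℝ)) : Type _ := lp (fun _ : F => ℝ) ∞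

/-- The bootstrap empirical process `f ↦ n^{1/2} (P_n^* - P̂_n) f` on `F`. -/
def bootProcessFun (Q : ∀ n, Measure (W n)) (γ : ∀ n, (Fin n → X) → W n → X)
    (F : Set (X → ℝ)) (n : ℕ) (x : Fin n → X) (w : Fin n → W n) : F → ℝ :=
  fun f => √(n : ℝ) * centered Q γ n x w f.1

/-- For every sample size, almost surely, the bootstrap empirical process is defined on all
of `F` and has a bounded sample path. -/
def BootProcessInEllInf (P₀ : Measure X) (Q : ∀ n, Measure (W n))
    (γ : ∀ n, (Fin n → X) → W n → X) (F : Set (X → ℝ)) : Prop :=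
  ∀ n : ℕ, 0 < n → ∀ᵐ x ∂(Measure.pi fun _ : Fin n => P₀),
    (∀ f ∈ F, Integrable f (Phat Q γ n x)) ∧
    ∀ᵐ w ∂(Measure.pi fun _ : Fin n => Q n), Memℓp (bootProcessFun Q γ F n x w) ∞

open scoped Classical in
/-- The bootstrap empirical process `G_n^*` as an element of `ℓ^∞(F)`, with the value `0`
where its sample path is unbounded. -/
def bootProcess (Q : ∀ n, Measure (W n)) (γ : ∀ n, (Fin n → X) → W n → X)
    (F : Set (X → ℝ)) (n : ℕ) (x : Fin n → X) (w : Fin n → W n) : EllInf F :=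
  if h : Memℓp (bootProcessFun Q γ F n x w) ∞ then ⟨bootProcessFun Q γ F n x w, h⟩ else 0

/-- `G₀` is a `P₀`-Brownian bridge indexed by `F ⊆ L₂(P₀)`: a mean zero Gaussian process with
covariance `P₀(fg) - P₀f P₀g`. -/
structure IsBrownianBridge {Ω : Type*} [MeasurableSpace Ω] (P₀ : Measure X) (F : Set (X → ℝ))
    (μ : Measure Ω) (G₀ : Ω → EllInf F) : Prop where
  memLp : ∀ f ∈ F, MemLp f 2 P₀
  gaussian : IsGaussianProcess (fun (f : F) (ω : Ω) => (G₀ ω : F → ℝ) f) μ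
  mean : ∀ f : F, ∫ ω, (G₀ ω : F → ℝ) f ∂μ = 0
  covar : ∀ f g : F,
    cov[fun ω => (G₀ ω : F → ℝ) f, fun ω => (G₀ ω : F → ℝ) g; μ]
      = ∫ y, f.1 y * g.1 y ∂P₀ - (∫ y, f.1 y ∂P₀) * ∫ y, g.1 y ∂P₀

/-- The centered bootstrap estimator `T(η_n^*, P_n^*) - T(η_n, P̂_n)`. -/
def bootDiff {H : Type*} (Q : ∀ n, Measure (W n)) (γ : ∀ n, (Fin n → X) → W n → X)
    (T : H → Measure X → ℝ) (η : ∀ n, (Fin n → X) → H)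
    (ηstar : ∀ n, (Fin n → X) → (Fin n → W n) → H) (n : ℕ) (x : Fin n → X)
    (w : Fin n → W n) : ℝ :=
  T (ηstar n x w) (Pstar γ n x w) - T (η n x) (Phat Q γ n x)

/-- The remainder `R_n^* = T(η_n^*, P_n^*) - T(η_n, P̂_n) - (P_n^* - P̂_n) φ_n^*`. -/
def bootRemainder {H : Type*} (Q : ∀ n, Measure (W n)) (γ : ∀ n, (Fin n → X) → W n → X)
    (T : H → Measure X → ℝ) (η : ∀ n, (Fin n → X) → H)
    (ηstar : ∀ n, (Fin n → X) → (Fin n → W n) → H)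
    (φstar : ∀ n, (Fin n → X) → (Fin n → W n) → X → ℝ) (n : ℕ) (x : Fin n → X)
    (w : Fin n → W n) : ℝ :=
  bootDiff Q γ T η ηstar n x w - centered Q γ n x w (φstar n x w)

end

end CondBootstrap

open CondBootstrap

/-!
Let `G` be tight in `ℓ^∞(F)` and continuous in probability at the index `φ₀`. Its increments
`|G f - G φ₀|` are then small, uniformly over all `f` near `φ₀`, off an event of small probability:
by tightness it suffices to look near finitely many points `z` of `ℓ^∞(F)`, and if the increments
of `z` itself stay large arbitrarily close to `φ₀`, then `G` is almost surely away from `z`.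
Testing weak convergence against `min 1 (dist (·, A))`, with `A` the set of paths whose increments
near `φ₀` are small, transfers this to `𝔾_n^*`. As `φ_n^*` lies near `φ₀` with conditional
probability tending to one, `𝔾_n^* φ_n^* - 𝔾_n^* φ₀` is conditionally negligible, so `φ_n^*` may be
replaced by `φ₀` in the remainder, which is the asserted linearity. The weak limit follows because
evaluation at `φ₀` is 1-Lipschitz and conditionally negligible perturbations do not affect weak
convergence.

The Brownian bridge is continuous in probability for the `L₂(P₀)` distance, since the variance
of `G₀ f - G₀ g` is the `P₀`-variance of `f - g`.
-/

namespace CondBootstrap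

section OuterExpectation

variable {Ω : Type*} [MeasurableSpace Ω] {μ : Measure Ω}

theorem integral_indicator_toMeasurable (A : Set Ω) (c : ℝ) :
    ∫ ω, (toMeasurable μ A).indicator (fun _ => c) ω ∂μ = μ.real A * c := by
  rw [integral_indicator_const c (measurableSet_toMeasurable μ A), smul_eq_mul, Measure.real,
    measure_toMeasurable, Measure.real]

variable [IsFiniteMeasure μ] {h g U : Ω → ℝ} {m M c : ℝ} {A : Set Ω}

theorem outerExp_le_integral (hm : ∀ ω, m ≤ h ω) (hUm : Measurable U) (hU : Integrable U μ)
    (hle : ∀ᵐ ω ∂μ, h ω ≤ U ω) : outerExp μ h ≤ ∫ ω, U ω ∂μ := by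
  refine csInf_le ⟨∫ _, m ∂μ, ?_⟩ ⟨U, hUm, hU, hle, rfl⟩
  rintro _ ⟨V, -, hV, hhV, rfl⟩
  exact integral_mono_ae (integrable_const m) hV (hhV.mono fun ω hω => (hm ω).trans hω)

theorem le_outerExp (hM : ∀ ω, h ω ≤ M)
    (hc : ∀ U : Ω → ℝ, Measurable U → Integrable U μ → (∀ᵐ ω ∂μ, h ω ≤ U ω) → c ≤ ∫ ω, U ω ∂μ) :
    c ≤ outerExp μ h := by
  refine le_csInf ⟨_, fun _ => M, measurable_const, integrable_const M, ae_of_all _ hM, rfl⟩ ?_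
  rintro _ ⟨U, hUm, hU, hle, rfl⟩
  exact hc U hUm hU hle

theorem outerExp_le_add_integral (hm : ∀ ω, m ≤ h ω) (hM : ∀ ω, g ω ≤ M) (hUm : Measurable U)
    (hU : Integrable U μ) (hle : ∀ᵐ ω ∂μ, h ω ≤ g ω + U ω) :
    outerExp μ h ≤ outerExp μ g + ∫ ω, U ω ∂μ := by
  rw [← sub_le_iff_le_add]
  refine le_outerExp hM fun V hVm hV hgV => ?_
  rw [sub_le_iff_le_add, ← integral_add hV hU]
  refine outerExp_le_integral hm (hVm.add hUm) (hV.add hU) ?_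
  filter_upwards [hle, hgV] with ω hω hgω
  exact hω.trans (by gcongr)

theorem mul_measureReal_le_outerExp (hc : 0 ≤ c) (h0 : ∀ ω, 0 ≤ h ω) (hM : ∀ ω, h ω ≤ M)
    (hA : ∀ ω ∈ A, c ≤ h ω) : c * μ.real A ≤ outerExp μ h := by
  refine le_outerExp hM fun U _ hU hle => ?_
  have hAU : ∀ᵐ ω ∂μ, ω ∈ A → c ≤ U ω := hle.mono fun ω hω hωA => (hA ω hωA).trans hω
  calc c * μ.real A ≤ c * μ.real {ω | c ≤ U ω} :=
        mul_le_mul_of_nonneg_left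
          (ENNReal.toReal_mono (measure_ne_top _ _) (measure_mono_ae hAU)) hc
    _ ≤ ∫ ω, U ω ∂μ :=
        mul_meas_ge_le_integral_of_nonneg (hle.mono fun ω hω => (h0 ω).trans hω) hU c

theorem outerProb_eq_measureReal (A : Set Ω) : outerProb μ A = μ.real A := by
  have hA := measurableSet_toMeasurable μ A
  have h0 : ∀ ω, 0 ≤ A.indicator (fun _ => (1 : ℝ)) ω :=
    Set.indicator_nonneg fun _ _ => zero_le_one
  refine le_antisymm ?_ ?_
  · calc outerProb μ A ≤ ∫ ω, (toMeasurable μ A).indicator (fun _ => (1 : ℝ)) ω ∂μ :=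
          outerExp_le_integral h0 (measurable_const.indicator hA)
            ((integrable_const 1).indicator hA) (ae_of_all _ fun ω =>
              Set.indicator_le_indicator_of_subset (subset_toMeasurable μ A)
                (fun _ => zero_le_one) ω)
      _ = μ.real A := by rw [integral_indicator_toMeasurable, mul_one]
  · calc μ.real A = 1 * μ.real A := (one_mul _).symm
      _ ≤ outerProb μ A := mul_measureReal_le_outerExp (M := 1) zero_le_one h0
          (Set.indicator_le_self' fun _ _ => zero_le_one) fun ω hω => by
            rw [Set.indicator_of_mem hω]

theorem condOuterProb_eq_measureReal {X : Type*} {W : ℕ → Type*} [∀ n, MeasurableSpace (W n)]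
    {Q : ∀ n, Measure (W n)} [∀ n, IsFiniteMeasure (Q n)] {n : ℕ}
    {A : (Fin n → X) → Set (Fin n → W n)} {x : Fin n → X} :
    condOuterProb Q n A x = (Measure.pi fun _ : Fin n => Q n).real (A x) :=
  outerProb_eq_measureReal _

end OuterExpectation

section BoundedOuterExpectation

variable {Ω : Type*} [MeasurableSpace Ω] {μ : Measure Ω} [IsProbabilityMeasure μ] {h g : Ω → ℝ}
  {a : ℝ} {A : Set Ω}

theorem abs_outerExp_le_one (hh : ∀ ω, |h ω| ≤ 1) : |outerExp μ h| ≤ 1 := by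
  refine abs_le.2 ⟨le_outerExp (fun ω => (abs_le.1 (hh ω)).2) fun U _ hU hle => ?_, ?_⟩
  · calc (-1 : ℝ) = ∫ _, (-1 : ℝ) ∂μ := by simp
      _ ≤ ∫ ω, U ω ∂μ := integral_mono_ae (integrable_const _) hU
          (hle.mono fun ω hω => (abs_le.1 (hh ω)).1.trans hω)
  · calc outerExp μ h ≤ ∫ _, (1 : ℝ) ∂μ :=
          outerExp_le_integral (fun ω => (abs_le.1 (hh ω)).1) measurable_const (integrable_const _)
            (ae_of_all _ fun ω => (abs_le.1 (hh ω)).2)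
      _ = 1 := by simp

theorem outerExp_le_of_forall_notMem (ha : 0 ≤ a) (hh : ∀ ω, |h ω| ≤ 1) (hg : ∀ ω, |g ω| ≤ 1)
    (hA : ∀ ω ∉ A, h ω - g ω ≤ a) : outerExp μ h ≤ outerExp μ g + (a + 2 * μ.real A) := by
  have hAm := measurableSet_toMeasurable μ A
  set V := (toMeasurable μ A).indicator fun _ => (2 : ℝ)
  have hV : Integrable V μ := (integrable_const 2).indicator hAm
  have hle : ∀ ω, h ω ≤ g ω + (a + V ω) := fun ω => by
    by_cases hω : ω ∈ toMeasurable μ A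
    · rw [show V ω = 2 from Set.indicator_of_mem hω _]
      linarith [(abs_le.1 (hh ω)).2, (abs_le.1 (hg ω)).1]
    · rw [show V ω = 0 from Set.indicator_of_notMem hω _]
      linarith [hA ω fun hωA => hω (subset_toMeasurable μ A hωA)]
  calc outerExp μ h ≤ outerExp μ g + ∫ ω, (a + V ω) ∂μ :=
        outerExp_le_add_integral (fun ω => (abs_le.1 (hh ω)).1) (fun ω => (abs_le.1 (hg ω)).2)
          ((measurable_const.indicator hAm).const_add a) ((integrable_const a).add hV)
          (ae_of_all _ hle)
    _ = outerExp μ g + (a + 2 * μ.real A) := by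
        rw [integral_add (integrable_const a) hV, integral_indicator_toMeasurable, integral_const,
          probReal_univ, one_smul, mul_comm]

theorem abs_outerExp_sub_outerExp_le (ha : 0 ≤ a) (hh : ∀ ω, |h ω| ≤ 1) (hg : ∀ ω, |g ω| ≤ 1)
    (hA : ∀ ω ∉ A, |h ω - g ω| ≤ a) : |outerExp μ h - outerExp μ g| ≤ a + 2 * μ.real A :=
  abs_sub_le_iff.2
    ⟨sub_le_iff_le_add'.2 <| outerExp_le_of_forall_notMem ha hh hg fun ω hω =>
        (abs_sub_le_iff.1 (hA ω hω)).1,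
      sub_le_iff_le_add'.2 <| outerExp_le_of_forall_notMem ha hg hh fun ω hω =>
        (abs_sub_le_iff.1 (hA ω hω)).2⟩

end BoundedOuterExpectation

section OuterConvergence

variable {X : Type*} [MeasurableSpace X] {P₀ : Measure X} [IsFiniteMeasure P₀]
  {Z Z' : ∀ n, (Fin n → X) → ℝ}

theorem tendstoInOuterProb_zero_iff :
    TendstoInOuterProb P₀ Z 0 ↔ ∀ ε : ℝ, 0 < ε →
      Tendsto (fun n => (Measure.pi fun _ : Fin n => P₀).real {x | ε ≤ |Z n x|}) atTop (𝓝 0) := by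
  simp only [TendstoInOuterProb, outerProb_eq_measureReal, sub_zero]

theorem tendstoInOuterProb_zero_of_le_add
    (h : ∀ τ : ℝ, 0 < τ → ∃ Z' : ∀ n, (Fin n → X) → ℝ, TendstoInOuterProb P₀ Z' 0 ∧
      ∀ᶠ n in atTop, ∀ᵐ x ∂(Measure.pi fun _ : Fin n => P₀), |Z n x| ≤ τ + Z' n x) :
    TendstoInOuterProb P₀ Z 0 := by
  refine tendstoInOuterProb_zero_iff.2 fun ε hε => ?_
  obtain ⟨Z', hZ', hle⟩ := h (ε / 2) (half_pos hε)
  refine squeeze_zero' (Eventually.of_forall fun _ => measureReal_nonneg) ?_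
    (tendstoInOuterProb_zero_iff.1 hZ' (ε / 2) (half_pos hε))
  filter_upwards [hle] with n hn
  refine ENNReal.toReal_mono (measure_ne_top _ _) (measure_mono_ae ?_)
  filter_upwards [hn] with x hx (hεx : ε ≤ |Z n x|)
  change ε / 2 ≤ |Z' n x|
  linarith [le_abs_self (Z' n x)]

theorem TendstoInOuterProb.add (hZ : TendstoInOuterProb P₀ Z 0)
    (hZ' : TendstoInOuterProb P₀ Z' 0) :
    TendstoInOuterProb P₀ (fun n x => Z n x + Z' n x) 0 := by
  rw [tendstoInOuterProb_zero_iff] at *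
  intro ε hε
  have hsum := (hZ (ε / 2) (half_pos hε)).add (hZ' (ε / 2) (half_pos hε))
  rw [add_zero] at hsum
  refine squeeze_zero (fun _ => measureReal_nonneg) (fun n => ?_) hsum
  refine (measureReal_mono fun x hx => ?_).trans (measureReal_union_le _ _)
  simp only [Set.mem_union, Set.mem_ofPred_eq] at hx ⊢
  by_contra! hlt
  linarith [abs_add_le (Z n x) (Z' n x)]

theorem TendstoInOuterProb.const_mul (hZ : TendstoInOuterProb P₀ Z 0) (c : ℝ) :
    TendstoInOuterProb P₀ (fun n x => c * Z n x) 0 := by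
  rw [tendstoInOuterProb_zero_iff] at *
  intro ε hε
  have hc : 0 < |c| + 1 := by positivity
  refine squeeze_zero (fun _ => measureReal_nonneg) (fun n => ?_)
    (hZ (ε / (|c| + 1)) (div_pos hε hc))
  refine measureReal_mono fun x (hx : ε ≤ |c * Z n x|) => (div_le_iff₀' hc).2 ?_
  rw [abs_mul] at hx
  exact hx.trans (by gcongr; linarith)

end OuterConvergence

section CondNegligible

variable {X : Type*} [MeasurableSpace X] {W : ℕ → Type*} [∀ n, MeasurableSpace (W n)]

/-- The events `A n`, which may depend on the data and on the auxiliary variables, have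
conditional outer probability given the data that tends to zero in outer probability. -/
def CondNegligible (P₀ : Measure X) (Q : ∀ n, Measure (W n))
    (A : ∀ n, (Fin n → X) → Set (Fin n → W n)) : Prop :=
  TendstoInOuterProb P₀ (fun n => condOuterProb Q n (A n)) 0

variable {P₀ : Measure X} [IsFiniteMeasure P₀] {Q : ∀ n, Measure (W n)}
  [∀ n, IsFiniteMeasure (Q n)] {A B : ∀ n, (Fin n → X) → Set (Fin n → W n)}

theorem condNegligible_of_measureReal_le
    (h : ∀ τ : ℝ, 0 < τ → ∃ Z : ∀ n, (Fin n → X) → ℝ, TendstoInOuterProb P₀ Z 0 ∧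
      ∀ᶠ n in atTop, ∀ᵐ x ∂(Measure.pi fun _ : Fin n => P₀),
        (Measure.pi fun _ : Fin n => Q n).real (A n x) ≤ τ + Z n x) :
    CondNegligible P₀ Q A :=
  tendstoInOuterProb_zero_of_le_add fun τ hτ => by
    simpa only [condOuterProb_eq_measureReal, abs_of_nonneg measureReal_nonneg] using h τ hτ

theorem CondNegligible.mono (hB : CondNegligible P₀ Q B)
    (hAB : ∀ᶠ n in atTop, ∀ᵐ x ∂(Measure.pi fun _ : Fin n => P₀),
      ∀ᵐ w ∂(Measure.pi fun _ : Fin n => Q n), w ∈ A n x → w ∈ B n x) :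
    CondNegligible P₀ Q A := by
  refine condNegligible_of_measureReal_le fun τ hτ => ⟨_, hB, ?_⟩
  filter_upwards [hAB] with n hn
  filter_upwards [hn] with x hx
  rw [condOuterProb_eq_measureReal]
  exact (ENNReal.toReal_mono (measure_ne_top _ _) (measure_mono_ae hx)).trans
    (le_add_of_nonneg_left hτ.le)

theorem CondNegligible.union (hA : CondNegligible P₀ Q A) (hB : CondNegligible P₀ Q B) :
    CondNegligible P₀ Q fun n x => A n x ∪ B n x := by
  refine condNegligible_of_measureReal_le fun τ hτ =>
    ⟨_, hA.add hB, Eventually.of_forall fun n => ae_of_all _ fun x => ?_⟩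
  rw [condOuterProb_eq_measureReal, condOuterProb_eq_measureReal]
  exact (measureReal_union_le _ _).trans (le_add_of_nonneg_left hτ.le)

theorem ofReal_mul_rpow_neg_half_le_enorm_iff {n : ℕ} (hn : 0 < n) {ε y : ℝ} :
    ENNReal.ofReal (ε * (n : ℝ) ^ (-(1 / 2) : ℝ)) ≤ ‖y‖ₑ ↔ ε ≤ √(n : ℝ) * |y| := by
  have hs : 0 < √(n : ℝ) := Real.sqrt_pos.2 (by exact_mod_cast hn)
  rw [Real.enorm_eq_ofReal_abs, ENNReal.ofReal_le_ofReal_iff (abs_nonneg _),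
    Real.rpow_neg (Nat.cast_nonneg n), ← Real.sqrt_eq_rpow, ← div_eq_mul_inv, div_le_iff₀' hs]

theorem isCondLittleO_rpow_neg_half_iff {Y : ∀ n, (Fin n → X) → (Fin n → W n) → ℝ} :
    IsCondLittleO P₀ Q (fun n x w => ‖Y n x w‖ₑ) (fun n => (n : ℝ) ^ (-(1 / 2) : ℝ)) ↔
      ∀ ε : ℝ, 0 < ε → CondNegligible P₀ Q fun n x => {w | ε ≤ √(n : ℝ) * |Y n x w|} := by
  refine forall₂_congr fun ε _ => ⟨fun h => CondNegligible.mono h ?_, fun h => h.mono ?_⟩ <;>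
    filter_upwards [eventually_gt_atTop 0] with n hn <;>
    refine ae_of_all _ fun x => ae_of_all _ fun w hw => ?_
  · exact (ofReal_mul_rpow_neg_half_le_enorm_iff hn).2 hw
  · exact (ofReal_mul_rpow_neg_half_le_enorm_iff hn).1 hw

end CondNegligible

section WeakConvergence

variable {Ω D E : Type*} [MeasurableSpace Ω] [PseudoMetricSpace D] [PseudoMetricSpace E]
  {μ : Measure Ω}

theorem IsTightBorel.comp_continuous {G : Ω → D} (hG : IsTightBorel μ G) {φ : D → E}
    (hφ : Continuous φ) : IsTightBorel μ fun ω => φ (G ω) := by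
  refine ⟨fun U hU => hG.1 _ (hU.preimage hφ), fun ε hε => ?_⟩
  obtain ⟨K, hK, hle⟩ := hG.2 ε hε
  refine ⟨φ '' K, hK.image hφ, (measure_mono fun ω hω hωK => ?_).trans hle⟩
  exact hω (Set.mem_image_of_mem φ hωK)

theorem BL₁_comp {φ : D → E} (hφ : LipschitzWith 1 φ) {h : E → ℝ} (hh : h ∈ BL₁ E) :
    (fun z => h (φ z)) ∈ BL₁ D :=
  ⟨by simpa only [one_mul, Function.comp_def] using hh.1.comp hφ, fun z => hh.2 (φ z)⟩

theorem min_one_infDist_mem_BL₁ (A : Set D) : (fun z => min 1 (Metric.infDist z A)) ∈ BL₁ D :=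
  ⟨(Metric.lipschitz_infDist_pt A).const_min 1, fun z => by
    rw [abs_of_nonneg (le_min zero_le_one Metric.infDist_nonneg)]
    exact min_le_left _ _⟩

variable {X : Type*} {W : ℕ → Type*} [∀ n, MeasurableSpace (W n)] {Q : ∀ n, Measure (W n)}
  [∀ n, IsProbabilityMeasure (Q n)] [IsProbabilityMeasure μ]

theorem abs_condOuterExp_sub_integral_le_iSup {n : ℕ} (Gn : (Fin n → X) → (Fin n → W n) → D)
    (G : Ω → D) (x : Fin n → X) {h : D → ℝ} (hh : h ∈ BL₁ D) :
    |condOuterExp Q n (fun x w => h (Gn x w)) x - ∫ ω, h (G ω) ∂μ| ≤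
      ⨆ h : BL₁ D, |condOuterExp Q n (fun x w => h.1 (Gn x w)) x - ∫ ω, h.1 (G ω) ∂μ| := by
  refine le_ciSup (f := fun h : BL₁ D =>
    |condOuterExp Q n (fun x w => h.1 (Gn x w)) x - ∫ ω, h.1 (G ω) ∂μ|) ⟨1 + 1, ?_⟩ ⟨h, hh⟩
  rintro _ ⟨h, rfl⟩
  have hint : |∫ ω, h.1 (G ω) ∂μ| ≤ 1 := by
    simpa using norm_integral_le_of_norm_le_const (μ := μ) (f := fun ω => h.1 (G ω)) (C := 1)
      (ae_of_all _ fun ω => h.2.2 (G ω))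
  exact (abs_sub _ _).trans (add_le_add (abs_outerExp_le_one fun w => h.2.2 _) hint)

theorem integral_min_one_infDist_le (G : Ω → D) (A : Set D) :
    ∫ ω, min 1 (Metric.infDist (G ω) A) ∂μ ≤ μ.real {ω | G ω ∉ A} := by
  have hB := measurableSet_toMeasurable μ {ω | G ω ∉ A}
  calc ∫ ω, min 1 (Metric.infDist (G ω) A) ∂μ
      ≤ ∫ ω, (toMeasurable μ {ω | G ω ∉ A}).indicator (fun _ => (1 : ℝ)) ω ∂μ := by
        refine integral_mono_of_nonneg
          (ae_of_all _ fun ω => le_min zero_le_one Metric.infDist_nonneg)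
          ((integrable_const 1).indicator hB) (ae_of_all _ fun ω => ?_)
        by_cases hω : ω ∈ toMeasurable μ {ω | G ω ∉ A}
        · rw [Set.indicator_of_mem hω]
          exact min_le_left _ _
        · have hGA : G ω ∈ A := not_not.1 fun hωA => hω (subset_toMeasurable μ _ hωA)
          rw [Set.indicator_of_notMem hω]
          exact (min_le_right _ _).trans_eq (Metric.infDist_zero_of_mem hGA)
    _ = μ.real {ω | G ω ∉ A} := by rw [integral_indicator_toMeasurable, mul_one]

theorem min_mul_measureReal_infDist_le {n : ℕ} (Gn : (Fin n → X) → (Fin n → W n) → D) (G : Ω → D)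
    (x : Fin n → X) (A : Set D) {δ : ℝ} (hδ : 0 < δ) :
    min 1 δ * (Measure.pi fun _ : Fin n => Q n).real {w | δ ≤ Metric.infDist (Gn x w) A} ≤
      μ.real {ω | G ω ∉ A} +
        ⨆ h : BL₁ D, |condOuterExp Q n (fun x w => h.1 (Gn x w)) x - ∫ ω, h.1 (G ω) ∂μ| := by
  have hmarkov : min 1 δ * (Measure.pi fun _ : Fin n => Q n).real
      {w | δ ≤ Metric.infDist (Gn x w) A} ≤
        condOuterExp Q n (fun x w => min 1 (Metric.infDist (Gn x w) A)) x :=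
    mul_measureReal_le_outerExp (le_min zero_le_one hδ.le)
      (fun w => le_min zero_le_one Metric.infDist_nonneg) (fun w => min_le_left _ _)
      fun w hw => min_le_min le_rfl hw
  have hsup := abs_condOuterExp_sub_integral_le_iSup (Q := Q) (μ := μ) Gn G x
    (min_one_infDist_mem_BL₁ A)
  linarith [(abs_le.1 hsup).2, integral_min_one_infDist_le (μ := μ) G A]

variable [MeasurableSpace X] {P₀ : Measure X} [IsFiniteMeasure P₀]
  {Gn Gn' : ∀ n, (Fin n → X) → (Fin n → W n) → D} {G : Ω → D}

theorem CondWeakConv.condNegligible (hG : CondWeakConv P₀ Q Gn μ G) {δ : ℝ} (hδ : 0 < δ)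
    {B : ∀ n, (Fin n → X) → Set (Fin n → W n)}
    (hB : ∀ τ : ℝ, 0 < τ → ∃ A : Set D, μ.real {ω | G ω ∉ A} ≤ τ ∧
      CondNegligible P₀ Q fun n x => B n x \ {w | δ ≤ Metric.infDist (Gn n x w) A}) :
    CondNegligible P₀ Q B := by
  refine condNegligible_of_measureReal_le fun τ hτ => ?_
  have hδ' : 0 < min 1 δ := lt_min one_pos hδ
  obtain ⟨A, hA, hBA⟩ := hB (min 1 δ * τ) (mul_pos hδ' hτ)
  refine ⟨_, hBA.add (hG.2.const_mul (min 1 δ)⁻¹),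
    Eventually.of_forall fun n => ae_of_all _ fun x => ?_⟩
  have hnear := (min_mul_measureReal_infDist_le (Q := Q) (μ := μ) (Gn n) G x A hδ).trans
    (add_le_add_left hA _)
  rw [← le_inv_mul_iff₀ hδ', mul_add, inv_mul_cancel_left₀ hδ'.ne'] at hnear
  rw [condOuterProb_eq_measureReal]
  have hsplit : (Measure.pi fun _ : Fin n => Q n).real (B n x) ≤
      (Measure.pi fun _ : Fin n => Q n).real (B n x \ {w | δ ≤ Metric.infDist (Gn n x w) A}) +
        (Measure.pi fun _ : Fin n => Q n).real {w | δ ≤ Metric.infDist (Gn n x w) A} :=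
    (measureReal_mono (Set.subset_sdiff_union _ _)).trans (measureReal_union_le _ _)
  linarith

theorem CondWeakConv.comp_lipschitzWith_one (hG : CondWeakConv P₀ Q Gn μ G) {φ : D → E}
    (hφ : LipschitzWith 1 φ) :
    CondWeakConv P₀ Q (fun n x w => φ (Gn n x w)) μ fun ω => φ (G ω) := by
  refine ⟨hG.1.comp_continuous hφ.continuous, tendstoInOuterProb_zero_of_le_add fun τ hτ =>
    ⟨_, hG.2, Eventually.of_forall fun n => ae_of_all _ fun x => ?_⟩⟩
  rw [abs_of_nonneg (Real.iSup_nonneg fun _ => abs_nonneg _)]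
  refine le_add_of_nonneg_of_le hτ.le (Real.iSup_le (fun h => ?_)
    (Real.iSup_nonneg fun _ => abs_nonneg _))
  exact abs_condOuterExp_sub_integral_le_iSup (Q := Q) (μ := μ) (Gn n) G x
    (h := fun z => h.1 (φ z)) (BL₁_comp hφ h.2)

theorem CondWeakConv.of_condNegligible_dist (hG : CondWeakConv P₀ Q Gn μ G)
    (hdist : ∀ ε : ℝ, 0 < ε →
      CondNegligible P₀ Q fun n x => {w | ε ≤ dist (Gn' n x w) (Gn n x w)}) :
    CondWeakConv P₀ Q Gn' μ G := by
  refine ⟨hG.1, tendstoInOuterProb_zero_of_le_add fun τ hτ =>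
    ⟨_, ((hdist τ hτ).const_mul 2).add hG.2,
      Eventually.of_forall fun n => ae_of_all _ fun x => ?_⟩⟩
  have hsup : 0 ≤ ⨆ h : BL₁ D,
      |condOuterExp Q n (fun x w => h.1 (Gn n x w)) x - ∫ ω, h.1 (G ω) ∂μ| :=
    Real.iSup_nonneg fun _ => abs_nonneg _
  rw [abs_of_nonneg (Real.iSup_nonneg fun _ => abs_nonneg _), condOuterProb_eq_measureReal]
  refine Real.iSup_le (fun h => ?_) (by positivity)
  have hclose : |condOuterExp Q n (fun x w => h.1 (Gn' n x w)) x -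
      condOuterExp Q n (fun x w => h.1 (Gn n x w)) x| ≤ τ +
        2 * (Measure.pi fun _ : Fin n => Q n).real {w | τ ≤ dist (Gn' n x w) (Gn n x w)} := by
    refine abs_outerExp_sub_outerExp_le hτ.le (fun w => h.2.2 _) (fun w => h.2.2 _) fun w hw => ?_
    simpa [Real.dist_eq] using (h.2.1.dist_le_mul _ _).trans
      ((one_mul _).trans_le (not_le.1 hw).le)
  have hlim := abs_condOuterExp_sub_integral_le_iSup (Q := Q) (μ := μ) (Gn n) G x h.2
  linarith [abs_sub_le (condOuterExp Q n (fun x w => h.1 (Gn' n x w)) x)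
    (condOuterExp Q n (fun x w => h.1 (Gn n x w)) x) (∫ ω, h.1 (G ω) ∂μ)]

end WeakConvergence

section Equicontinuity

variable {ι : Type*}

theorem abs_sub_le_abs_sub_add_two_mul_dist (z z' : lp (fun _ : ι => ℝ) ∞) (i j : ι) :
    |z i - z j| ≤ |z' i - z' j| + 2 * dist z z' := by
  have hi := (lp.lipschitzWith_one_eval ∞ i).dist_le_mul z z'
  have hj := (lp.lipschitzWith_one_eval ∞ j).dist_le_mul z z'
  simp only [Real.dist_eq, NNReal.coe_one, one_mul] at hi hj
  rw [abs_le] at *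
  have habs := abs_le.1 (le_refl |z' i - z' j|)
  constructor <;> linarith [hi.1, hi.2, hj.1, hj.2, habs.1, habs.2]

variable {Ω : Type*} [MeasurableSpace Ω] {μ : Measure Ω} {G : Ω → lp (fun _ : ι => ℝ) ∞}
  {l : Filter ι} {i₀ : ι}

-- If `G ω` is close to `z` then its increments inherit the size of those of `z`, uniformly over
-- the index, whereas each increment alone is large with vanishing probability.
theorem ae_le_dist_of_frequently_le_abs_sub
    (hG : TendstoInMeasure μ (fun i ω => G ω i) l fun ω => G ω i₀) {z : lp (fun _ : ι => ℝ) ∞}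
    {ε : ℝ} (hε : 0 < ε) (hz : ∃ᶠ i in l, 3 * ε ≤ |z i - z i₀|) :
    ∀ᵐ ω ∂μ, ε ≤ dist (G ω) z := by
  rw [ae_iff, ← nonpos_iff_eq_zero]
  refine le_of_forall_gt_imp_ge_of_dense fun b hb => ?_
  have hsmall := (tendstoInMeasure_iff_dist.1 hG ε hε).eventually_le_const hb
  obtain ⟨i, hzi, hi⟩ := (hz.and_eventually hsmall).exists
  refine (measure_mono fun ω hω => ?_).trans hi
  have hωz : dist z (G ω) < ε := by rw [dist_comm]; exact not_le.1 hω
  change ε ≤ dist (G ω i) (G ω i₀)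
  rw [Real.dist_eq]
  linarith [abs_sub_le_abs_sub_add_two_mul_dist z (G ω) i i₀]

theorem exists_mem_ae_abs_sub_lt_of_totallyBounded
    (hG : TendstoInMeasure μ (fun i ω => G ω i) l fun ω => G ω i₀)
    {K : Set (lp (fun _ : ι => ℝ) ∞)} (hK : TotallyBounded K) {ε : ℝ} (hε : 0 < ε) :
    ∃ S ∈ l, ∀ᵐ ω ∂μ, G ω ∈ K → ∀ i ∈ S, |G ω i - G ω i₀| < ε := by
  have hε' : 0 < ε / 5 := by positivity
  obtain ⟨t, ht, hKt⟩ := Metric.totallyBounded_iff.1 hK (ε / 5) hε'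
  let good : Set (lp (fun _ : ι => ℝ) ∞) := {z | ∀ᶠ i in l, |z i - z i₀| < 3 * (ε / 5)}
  have hbad : ∀ᵐ ω ∂μ, ∀ z ∈ t \ good, ε / 5 ≤ dist (G ω) z :=
    (ae_ball_iff (ht.sdiff.countable)).2 fun z hz =>
      ae_le_dist_of_frequently_le_abs_sub hG hε' <| by
        simpa only [good, Set.mem_ofPred_eq, not_eventually, not_lt] using hz.2
  refine ⟨{i | ∀ z ∈ t ∩ good, |z i - z i₀| < 3 * (ε / 5)},
    (eventually_all_finite (ht.inter_of_left good)).2 fun z hz => hz.2, ?_⟩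
  filter_upwards [hbad] with ω hω hωK i hi
  obtain ⟨z, hzt, hzω⟩ := Set.mem_iUnion₂.1 (hKt hωK)
  have hz : z ∈ good := by
    by_contra hz
    exact (hω z ⟨hzt, hz⟩).not_gt hzω
  linarith [hi z ⟨hzt, hz⟩, abs_sub_le_abs_sub_add_two_mul_dist (G ω) z i i₀,
    Metric.mem_ball.1 hzω]

theorem IsTightBorel.exists_mem_measure_le (ht : IsTightBorel μ G)
    (hG : TendstoInMeasure μ (fun i ω => G ω i) l fun ω => G ω i₀) {ε : ℝ} (hε : 0 < ε)
    {τ : ℝ≥0∞} (hτ : 0 < τ) :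
    ∃ S ∈ l, μ {ω | ∃ i ∈ S, ε ≤ |G ω i - G ω i₀|} ≤ τ := by
  obtain ⟨K, hK, hKτ⟩ := ht.2 τ hτ
  obtain ⟨S, hS, hSK⟩ := exists_mem_ae_abs_sub_lt_of_totallyBounded hG hK.totallyBounded hε
  refine ⟨S, hS, (measure_mono_ae ?_).trans hKτ⟩
  filter_upwards [hSK] with ω hω ⟨i, hi, hle⟩ hωK
  exact (hω hωK i hi).not_ge hle

theorem div_four_le_infDist {S : Set ι} {z : lp (fun _ : ι => ℝ) ∞} {i : ι} {ε : ℝ} (hε : 0 ≤ ε)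
    (hi : i ∈ S) (hz : ε ≤ |z i - z i₀|) :
    ε / 4 ≤ Metric.infDist z {y | ∀ j ∈ S, |y j - y i₀| ≤ ε / 2} := by
  refine (Metric.le_infDist ⟨0, fun j _ => ?_⟩).2 fun y hy => ?_
  · simpa using div_nonneg hε zero_le_two
  · linarith [hy i hi, abs_sub_le_abs_sub_add_two_mul_dist z y i i₀]

variable [IsProbabilityMeasure μ] {X : Type*} [MeasurableSpace X] {P₀ : Measure X}
  [IsFiniteMeasure P₀] {W : ℕ → Type*} [∀ n, MeasurableSpace (W n)] {Q : ∀ n, Measure (W n)}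
  [∀ n, IsProbabilityMeasure (Q n)] {Gn : ∀ n, (Fin n → X) → (Fin n → W n) → lp (fun _ : ι => ℝ) ∞}

theorem CondWeakConv.condNegligible_increment (hconv : CondWeakConv P₀ Q Gn μ G)
    (hG : TendstoInMeasure μ (fun i ω => G ω i) l fun ω => G ω i₀)
    {J : ∀ n, (Fin n → X) → (Fin n → W n) → Set ι}
    (hJ : ∀ S ∈ l, CondNegligible P₀ Q fun n x => {w | ¬ J n x w ⊆ S}) {ε : ℝ} (hε : 0 < ε) :
    CondNegligible P₀ Q fun n x => {w | ∃ i ∈ J n x w, ε ≤ |Gn n x w i - Gn n x w i₀|} := by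
  refine hconv.condNegligible (δ := ε / 4) (by positivity) fun τ hτ => ?_
  obtain ⟨S, hS, hSτ⟩ :=
    hconv.1.exists_mem_measure_le hG (half_pos hε) (ENNReal.ofReal_pos.2 hτ)
  refine ⟨{z | ∀ i ∈ S, |z i - z i₀| ≤ ε / 2}, ?_, (hJ S hS).mono <|
    Eventually.of_forall fun n => ae_of_all _ fun x => ae_of_all _ fun w => ?_⟩
  · refine ENNReal.toReal_le_of_le_ofReal hτ.le ((measure_mono fun ω hω => ?_).trans hSτ)
    simp only [Set.mem_ofPred_eq, not_forall, not_le] at hω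
    obtain ⟨i, hi, hlt⟩ := hω
    exact ⟨i, hi, hlt.le⟩
  · rintro ⟨⟨i, hiJ, hle⟩, hnear⟩ hJS
    exact hnear (div_four_le_infDist hε.le (hJS hiJ) hle)

end Equicontinuity

section BrownianBridge

variable {X : Type*} [MeasurableSpace X] {P₀ : Measure X}

theorem eLpNorm_two_sq_eq_lintegral (d : X → ℝ) :
    eLpNorm d 2 P₀ ^ 2 = ∫⁻ y, ‖d y‖ₑ ^ 2 ∂P₀ := by
  simpa using eLpNorm_nnreal_pow_eq_lintegral (μ := P₀) (f := d) (p := 2) two_ne_zero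

variable {F : Set (X → ℝ)} {Ω : Type*} [MeasurableSpace Ω] {μ : Measure Ω} {G₀ : Ω → EllInf F}

theorem IsBrownianBridge.memLp_apply (h : IsBrownianBridge P₀ F μ G₀) (f : F) :
    MemLp (fun ω => G₀ ω f) 2 μ :=
  (h.gaussian.hasGaussianLaw_eval f).memLp_two

variable [IsProbabilityMeasure P₀]

theorem evariance_le_eLpNorm_sq {d : X → ℝ} (hd : MemLp d 2 P₀) :
    eVar[d; P₀] ≤ eLpNorm d 2 P₀ ^ 2 := by
  calc eVar[d; P₀] = ENNReal.ofReal Var[d; P₀] := (ofReal_variance hd).symm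
    _ ≤ ENNReal.ofReal (∫ y, d y ^ 2 ∂P₀) :=
        ENNReal.ofReal_le_ofReal (variance_le_expectation_sq hd.1)
    _ = eLpNorm d 2 P₀ ^ 2 := by
        rw [ofReal_integral_eq_lintegral_ofReal hd.integrable_sq
          (ae_of_all _ fun y => sq_nonneg (d y)), eLpNorm_two_sq_eq_lintegral]
        simp only [← Real.enorm_of_nonneg (sq_nonneg _), enorm_pow]

theorem IsBrownianBridge.covariance_apply (h : IsBrownianBridge P₀ F μ G₀) (f g : F) :
    cov[fun ω => G₀ ω f, fun ω => G₀ ω g; μ] = cov[f.1, g.1; P₀] := by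
  rw [h.covar, covariance_eq_sub (h.memLp f.1 f.2) (h.memLp g.1 g.2)]
  rfl

variable [IsProbabilityMeasure μ]

theorem IsBrownianBridge.variance_sub (h : IsBrownianBridge P₀ F μ G₀) (f g : F) :
    Var[fun ω => G₀ ω f - G₀ ω g; μ] = Var[fun y => f.1 y - g.1 y; P₀] := by
  have hvar : ∀ f : F, Var[fun ω => G₀ ω f; μ] = Var[f.1; P₀] := fun f => by
    rw [← covariance_self (h.memLp_apply f).1.aemeasurable, h.covariance_apply,
      covariance_self (h.memLp f.1 f.2).1.aemeasurable]
  rw [variance_fun_sub (h.memLp_apply f) (h.memLp_apply g),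
    variance_fun_sub (h.memLp f.1 f.2) (h.memLp g.1 g.2), hvar, hvar, h.covariance_apply]

theorem IsBrownianBridge.eLpNorm_sub_le (h : IsBrownianBridge P₀ F μ G₀) (f g : F) :
    eLpNorm (fun ω => G₀ ω f - G₀ ω g) 2 μ ≤ eLpNorm (fun y => f.1 y - g.1 y) 2 P₀ := by
  have hmean : ∫ ω, (G₀ ω f - G₀ ω g) ∂μ = 0 := by
    rw [integral_sub ((h.memLp_apply f).integrable one_le_two)
      ((h.memLp_apply g).integrable one_le_two), h.mean, h.mean, sub_zero]
  have hG : MemLp (fun ω => G₀ ω f - G₀ ω g) 2 μ := (h.memLp_apply f).sub (h.memLp_apply g)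
  have hfg : MemLp (fun y => f.1 y - g.1 y) 2 P₀ := (h.memLp f.1 f.2).sub (h.memLp g.1 g.2)
  refine (ENNReal.pow_le_pow_left_iff two_ne_zero).1 ?_
  calc eLpNorm (fun ω => G₀ ω f - G₀ ω g) 2 μ ^ 2 = eVar[fun ω => G₀ ω f - G₀ ω g; μ] := by
        rw [eLpNorm_two_sq_eq_lintegral, evariance, hmean]
        simp only [sub_zero]
    _ = eVar[fun y => f.1 y - g.1 y; P₀] := by
        rw [← ofReal_variance hG, ← ofReal_variance hfg, h.variance_sub]
    _ ≤ eLpNorm (fun y => f.1 y - g.1 y) 2 P₀ ^ 2 := evariance_le_eLpNorm_sq hfg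

theorem IsBrownianBridge.tendstoInMeasure (h : IsBrownianBridge P₀ F μ G₀) (g : F) :
    TendstoInMeasure μ (fun (f : F) ω => G₀ ω f)
      (comap (fun f : F => eLpNorm (fun y => f.1 y - g.1 y) 2 P₀) (𝓝 0)) fun ω => G₀ ω g :=
  tendstoInMeasure_of_tendsto_eLpNorm two_ne_zero (fun f => (h.memLp_apply f).1)
    (h.memLp_apply g).1 <| tendsto_of_tendsto_of_tendsto_of_le_of_le tendsto_const_nhds
      tendsto_comap (fun _ => zero_le) fun f => h.eLpNorm_sub_le f g

end BrownianBridge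

theorem BootProcessInEllInf.ae_bootProcess_apply {X : Type*} [MeasurableSpace X] {P₀ : Measure X}
    {W : ℕ → Type*} [∀ n, MeasurableSpace (W n)] {Q : ∀ n, Measure (W n)}
    {γ : ∀ n, (Fin n → X) → W n → X} {F : Set (X → ℝ)} (h : BootProcessInEllInf P₀ Q γ F)
    (n : ℕ) (hn : 0 < n) :
    ∀ᵐ x ∂(Measure.pi fun _ : Fin n => P₀), ∀ᵐ w ∂(Measure.pi fun _ : Fin n => Q n),
      ∀ f : F, bootProcess Q γ F n x w f = √(n : ℝ) * centered Q γ n x w f.1 := by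
  filter_upwards [h n hn] with x hx
  filter_upwards [hx.2] with w hw f
  rw [bootProcess, dif_pos hw]
  rfl

section Linearization

variable {X : Type*} [MeasurableSpace X] {P₀ : Measure X} [IsFiniteMeasure P₀]
  {W : ℕ → Type*} [∀ n, MeasurableSpace (W n)] {Q : ∀ n, Measure (W n)}
  [∀ n, IsProbabilityMeasure (Q n)] {Θ : Type*} {F : Set Θ} {Ω : Type*} [MeasurableSpace Ω]
  {μ : Measure Ω} [IsProbabilityMeasure μ] {φ₀ : Θ} {ρ : Θ → ℝ≥0∞}
  {φstar : ∀ n, (Fin n → X) → (Fin n → W n) → Θ} {L : ∀ n, (Fin n → X) → (Fin n → W n) → Θ → ℝ}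
  {D : ∀ n, (Fin n → X) → (Fin n → W n) → ℝ}
  {Gn : ∀ n, (Fin n → X) → (Fin n → W n) → lp (fun _ : F => ℝ) ∞} {G : Ω → lp (fun _ : F => ℝ) ∞}

theorem condNegligible_not_subset_of_isCondLittleO
    (hcons : IsCondLittleO P₀ Q (fun n x w => ρ (φstar n x w)) fun _ => 1) {S : Set F}
    (hS : S ∈ comap (fun f : F => ρ f) (𝓝 0)) :
    CondNegligible P₀ Q fun n x => {w | ¬ {f : F | f.1 = φstar n x w} ⊆ S} := by
  obtain ⟨a, ha, haS⟩ := (ENNReal.nhds_zero_basis.comap _).mem_iff.1 hS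
  obtain ⟨δ, hδ, hδa⟩ := ENNReal.lt_iff_exists_nnreal_btwn.1 ha
  refine CondNegligible.mono (hcons δ (by exact_mod_cast hδ)) <|
    Eventually.of_forall fun n => ae_of_all _ fun x => ae_of_all _ fun w hw => ?_
  obtain ⟨f, hf, hfS⟩ := Set.not_subset.1 hw
  have hle : a ≤ ρ f := not_lt.1 fun hlt => hfS (haS hlt)
  change ENNReal.ofReal (δ * 1) ≤ ρ (φstar n x w)
  rw [mul_one, ENNReal.ofReal_coe_nnreal, ← hf]
  exact hδa.le.trans hle

theorem isCondLittleO_sub_of_condWeakConv (hφ₀ : φ₀ ∈ F)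
    (hφstar : CondNegligible P₀ Q fun n x => {w | φstar n x w ∉ F})
    (hGn : ∀ n, 0 < n → ∀ᵐ x ∂(Measure.pi fun _ : Fin n => P₀),
      ∀ᵐ w ∂(Measure.pi fun _ : Fin n => Q n), ∀ f : F, Gn n x w f = √(n : ℝ) * L n x w f)
    (hconv : CondWeakConv P₀ Q Gn μ G)
    (hG : TendstoInMeasure μ (fun (f : F) ω => G ω f) (comap (fun f : F => ρ f) (𝓝 0))
      fun ω => G ω ⟨φ₀, hφ₀⟩)
    (hcons : IsCondLittleO P₀ Q (fun n x w => ρ (φstar n x w)) fun _ => 1)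
    (hrem : IsCondLittleO P₀ Q (fun n x w => ‖D n x w - L n x w (φstar n x w)‖ₑ)
      fun n => (n : ℝ) ^ (-(1 / 2) : ℝ)) :
    IsCondLittleO P₀ Q (fun n x w => ‖D n x w - L n x w φ₀‖ₑ)
      fun n => (n : ℝ) ^ (-(1 / 2) : ℝ) := by
  rw [isCondLittleO_rpow_neg_half_iff] at hrem ⊢
  intro ε hε
  have hinc := hconv.condNegligible_increment hG
    (fun S hS => condNegligible_not_subset_of_isCondLittleO hcons hS) (half_pos hε)
  refine (((hrem (ε / 2) (half_pos hε)).union hφstar).union hinc).mono ?_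
  filter_upwards [eventually_gt_atTop 0] with n hn
  filter_upwards [hGn n hn] with x hx
  filter_upwards [hx] with w hw (hεw : ε ≤ _)
  by_contra hcon
  simp only [Set.mem_union, Set.mem_ofPred_eq, not_or, not_le, not_not] at hcon
  obtain ⟨⟨hsmall, hmem⟩, hnoinc⟩ := hcon
  have hinc' : √(n : ℝ) * |L n x w (φstar n x w) - L n x w φ₀| < ε / 2 := by
    have hlt := not_le.1 fun hle => hnoinc ⟨⟨φstar n x w, hmem⟩, rfl, hle⟩
    rwa [hw, hw, ← mul_sub, abs_mul, abs_of_nonneg (Real.sqrt_nonneg _)] at hlt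
  have htri := mul_le_mul_of_nonneg_left (abs_sub_le (D n x w) (L n x w (φstar n x w))
    (L n x w φ₀)) (Real.sqrt_nonneg (n : ℝ))
  rw [mul_add] at htri
  linarith

theorem condWeakConv_sqrt_mul_of_isCondLittleO (hφ₀ : φ₀ ∈ F)
    (hGn : ∀ n, 0 < n → ∀ᵐ x ∂(Measure.pi fun _ : Fin n => P₀),
      ∀ᵐ w ∂(Measure.pi fun _ : Fin n => Q n), ∀ f : F, Gn n x w f = √(n : ℝ) * L n x w f)
    (hconv : CondWeakConv P₀ Q Gn μ G)
    (hlin : IsCondLittleO P₀ Q (fun n x w => ‖D n x w - L n x w φ₀‖ₑ)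
      fun n => (n : ℝ) ^ (-(1 / 2) : ℝ)) :
    CondWeakConv P₀ Q (fun n x w => √(n : ℝ) * D n x w) μ fun ω => G ω ⟨φ₀, hφ₀⟩ := by
  refine (hconv.comp_lipschitzWith_one
    (lp.lipschitzWith_one_eval ∞ (⟨φ₀, hφ₀⟩ : F))).of_condNegligible_dist fun ε hε => ?_
  refine (isCondLittleO_rpow_neg_half_iff.1 hlin ε hε).mono ?_
  filter_upwards [eventually_gt_atTop 0] with n hn
  filter_upwards [hGn n hn] with x hx
  filter_upwards [hx] with w hw (hεw : ε ≤ _)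
  rwa [hw, Real.dist_eq, ← mul_sub, abs_mul, abs_of_nonneg (Real.sqrt_nonneg _)] at hεw

end Linearization

end CondBootstrap

theorem theorem2_general
    {X : Type*} [MeasurableSpace X] {P₀ : Measure X} [IsFiniteMeasure P₀]
    {W : ℕ → Type*} [∀ n, MeasurableSpace (W n)] {Q : ∀ n, Measure (W n)}
    [∀ n, IsProbabilityMeasure (Q n)] {Θ : Type*} {F : Set Θ} {φ₀ : Θ} (hφ₀ : φ₀ ∈ F)
    {ρ : Θ → ℝ≥0∞} {φstar : ∀ n, (Fin n → X) → (Fin n → W n) → Θ}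
    {L : ∀ n, (Fin n → X) → (Fin n → W n) → Θ → ℝ} {D : ∀ n, (Fin n → X) → (Fin n → W n) → ℝ}
    {Gn : ∀ n, (Fin n → X) → (Fin n → W n) → lp (fun _ : F => ℝ) ∞}
    {Ω : Type*} [MeasurableSpace Ω] {μ : Measure Ω} [IsProbabilityMeasure μ]
    {G : Ω → lp (fun _ : F => ℝ) ∞}
    (hφstar : TendstoInOuterProb P₀
      (fun n => condOuterProb Q n fun x => {w | φstar n x w ∉ F}) 0)
    (hGn : ∀ n, 0 < n → ∀ᵐ x ∂(Measure.pi fun _ : Fin n => P₀),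
      ∀ᵐ w ∂(Measure.pi fun _ : Fin n => Q n), ∀ f : F, Gn n x w f = √(n : ℝ) * L n x w f)
    (hconv : CondWeakConv P₀ Q Gn μ G)
    (hG : TendstoInMeasure μ (fun (f : F) ω => G ω f) (comap (fun f : F => ρ f) (𝓝 0))
      fun ω => G ω ⟨φ₀, hφ₀⟩)
    (hcons : IsCondLittleO P₀ Q (fun n x w => ρ (φstar n x w)) fun _ => 1)
    (hrem : IsCondLittleO P₀ Q (fun n x w => ‖D n x w - L n x w (φstar n x w)‖ₑ)
      fun n => (n : ℝ) ^ (-(1 / 2) : ℝ)) :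
    IsCondLittleO P₀ Q (fun n x w => ‖D n x w - L n x w φ₀‖ₑ)
      (fun n => (n : ℝ) ^ (-(1 / 2) : ℝ)) ∧
    CondWeakConv P₀ Q (fun n x w => √(n : ℝ) * D n x w) μ fun ω => G ω ⟨φ₀, hφ₀⟩ := by
  have hlin := isCondLittleO_sub_of_condWeakConv hφ₀ hφstar hGn hconv hG hcons hrem
  exact ⟨hlin, condWeakConv_sqrt_mul_of_isCondLittleO hφ₀ hGn hconv hlin⟩

theorem theorem2
    {X : Type*} [MeasurableSpace X] (P₀ : Measure X) [IsProbabilityMeasure P₀]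
    -- the auxiliary randomization and the bootstrap sampling mechanism
    {W : ℕ → Type*} [∀ n, MeasurableSpace (W n)]
    (Q : ∀ n, Measure (W n)) [∀ n, IsProbabilityMeasure (Q n)]
    (γ : ∀ n, (Fin n → X) → W n → X)
    (hγ : ∀ n, Measurable fun p : (Fin n → X) × W n => γ n p.1 p.2)
    -- the estimator construction, the nuisance estimators, the influence function and its estimator
    {H : Type*} (T : H → Measure X → ℝ) (η : ∀ n, (Fin n → X) → H)
    (ηstar : ∀ n, (Fin n → X) → (Fin n → W n) → H)
    (φ₀ : X → ℝ) (φstar : ∀ n, (Fin n → X) → (Fin n → W n) → X → ℝ)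
    -- the class `F` and the limit process
    (F : Set (X → ℝ)) (hF : ∀ f ∈ F, Measurable f)
    (hφ₀ : φ₀ ∈ F)
    (hφstar : TendstoInOuterProb P₀
      (fun n => condOuterProb Q n fun x => {w | φstar n x w ∉ F}) 0)
    {Ω : Type*} [MeasurableSpace Ω] (μ : Measure Ω) [IsProbabilityMeasure μ]
    (G₀ : Ω → EllInf F) (hG₀ : IsBrownianBridge P₀ F μ G₀)
    (hbdd : BootProcessInEllInf P₀ Q γ F)
    (hconv : CondWeakConv P₀ Q (bootProcess Q γ F) μ G₀)
    -- conditional consistency of the influence function estimator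
    (hcons : IsCondLittleO P₀ Q
      (fun n x w => eLpNorm (fun y => φstar n x w y - φ₀ y) 2 P₀) fun _ => 1)
    -- conditional negligibility of the remainder
    (hrem : IsCondLittleO P₀ Q
      (fun n x w => ‖bootRemainder Q γ T η ηstar φstar n x w‖ₑ)
      fun n => (n : ℝ) ^ (-(1 / 2) : ℝ)) :
    IsCondLittleO P₀ Q
      (fun n x w => ‖bootDiff Q γ T η ηstar n x w - centered Q γ n x w φ₀‖ₑ)
      (fun n => (n : ℝ) ^ (-(1 / 2) : ℝ)) ∧
    CondWeakConv P₀ Q (fun n x w => √(n : ℝ) * bootDiff Q γ T η ηstar n x w)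
      μ (fun ω => (G₀ ω : F → ℝ) ⟨φ₀, hφ₀⟩) :=
  theorem2_general (L := centered Q γ) (D := bootDiff Q γ T η ηstar)
    (ρ := fun f => eLpNorm (fun y => f y - φ₀ y) 2 P₀) hφ₀ hφstar hbdd.ae_bootProcess_apply hconv
    (hG₀.tendstoInMeasure ⟨φ₀, hφ₀⟩) hcons hrem
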